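/- Let $\mathcal V$ be a semi-abelian variety, i.e. a finitary variety of universal algebras which, as a category, is pointed, Barr-exact, Bourn-protomodular and has binary coproducts. Let $V\colon\mathcal V\to\mathrm{Set}$ be the forgetful functor. Notation. For objects $A,B,C$, the cosmash products $h_{A,B}\colon A\diamond B\to A+B$ and $h_{A,B,C}\colon A\diamond B\diamond C\to A+B+C$ are the kernels of the canonical morphisms $A+B\to A\times B$ and $A+B+C\to(A+B)\times(A+C)\times(B+C)$; they are functorial in each variable. The folding morphisms $S_{2,1}\colon A\diamond A\diamond B\to A\diamond B$ and $S_{1,2}\colon A\diamond B\diamond B\to A\diamond B$ are the restrictions of $\langle 1_A,1_A\rangle+1_B$ and $1_A+\langle 1_B,1_B\rangle$. Here $\langle f,g\rangle$ denotes the morphism out of a coproduct with components $f$ and $g$. The object $A\flat X$ is the kernel $\kappa_{A,X}\colon A\flat X\to A+X$ of $\langle 1_A,0\rangle\colon A+X\to A$. The action core of a split extension with kernel $k\colon X\to E$, split epimorphism $p\colon E\to A$ and section $s\colon A\to E$ is the unique $\psi\colon A\diamond X\to X$ with $k\psi=\langle s,k\rangle h_{A,X}$. The conjugation action core is $\overline{\chi_A}=\langle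 1_A,1_A\rangle h_{A,A}\colon A\diamond A\to A$. For a kernel $k\colon Y\to X$, $\overline\chi\colon X\diamond Y\to Y$ is the unique morphism with $k\overline\chi=\overline{\chi_X}(1_X\diamond k)$. An internal crossed module in $\mathcal V$ is a quadruple $(T,G,\psi,\partial)$ with $\partial\colon T\to G$ a morphism and $\psi\colon G\diamond T\to T$ the action core of some split extension of $G$ by $T$, such that $$\partial\psi=\overline{\chi_G}(1_G\diamond\partial),\qquad \psi(\partial\diamond 1_T)=\overline{\chi_T},\qquad \psi S_{2,1}(1_G\diamond\partial\diamond 1_T)=\psi S_{1,2}.$$ A morphism $(T,G,\psi,\partial)\to(T',G',\psi',\partial')$ is a pair $(f_T\colon T\to T',\,f_G\colon G\to G')$ of morphisms of $\mathcal V$ with $f_G\partial=\partial' f_T$ and $f_T\psi=\psi'(f_G\diamond f_T)$. This defines the category $\mathrm{XMod}(\mathcal V)$. Statement. 1. The functor $L\colon\mathcal V\to\mathrm{XMod}(\mathcal V)$, $L(H)=(H\flat H,\;H+H,\;\overline\chi,\;\kappa_{H,H})$, $L(f)=(f\flat f,f+f)$, is left adjoint to the functor $R\colon\mathrm{XMod}(\mathcal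 V)\to\mathcal V$, $R(T,G,\psi,\partial)=T\times G$, $R(f_T,f_G)=f_T\times f_G$. 2. The forgetful functor $V$ has a left adjoint, and for every left adjoint $F$ of $V$ (free functor) the composite $LF$ (first $F$, then $L$) is left adjoint to $VR\colon\mathrm{XMod}(\mathcal V)\to\mathrm{Set}$. Moreover every internal crossed module which is free on a set $X$ with respect to $VR$ is isomorphic to $$L(F(X))=\bigl(F(X)\flat F(X),\;F(X)+F(X),\;\overline\chi,\;\kappa_{F(X),F(X)}\bigr).$$ -/

import Mathlib

open CategoryTheory CategoryTheory.Limits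

universe u v

set_option linter.unusedSectionVars false

noncomputable section

namespace SemiAb

section Categories

variable (C : Type u) [Category.{v} C]

/-- Bourn protomodularity: for every `v : A ⟶ B`, the change-of-base functor from points
(split epimorphisms with a chosen section) over `B` to points over `A` reflects isomorphisms.
Here `(E, p, s)` and `(E', p', s')` are points over `B`, `f` is a morphism of points, the two
pullback squares are the objects along `v`, and `g` is the morphism induced by `f`. -/
def IsProtomodular : Prop :=
  ∀ ⦃A B E E' P P' : C⦄ (v : A ⟶ B) (p : E ⟶ B) (s : B ⟶ E) (p' : E' ⟶ B) (s' : B ⟶ E')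
    (f : E ⟶ E') (q : P ⟶ A) (w : P ⟶ E) (q' : P' ⟶ A) (w' : P' ⟶ E') (g : P ⟶ P'),
    s ≫ p = 𝟙 B → s' ≫ p' = 𝟙 B → f ≫ p' = p → s ≫ f = s' →
    IsPullback w q p v → IsPullback w' q' p' v → g ≫ q' = q → g ≫ w' = w ≫ f →
    IsIso g → IsIso f

/-- Semi-abelian categories: pointed, Barr-exact (regular, with every internal
equivalence relation effective), Bourn-protomodular, with binary coproducts. -/
class SemiAbelian [HasZeroMorphisms C] : Prop extends Regular C where
  hasZeroObject : HasZeroObject C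
  hasBinaryCoproducts : HasBinaryCoproducts C
  effective : ∀ ⦃R X : C⦄ (r₁ r₂ : R ⟶ X), IsEquivalenceRelation r₁ r₂ →
    IsEffectiveEquivalenceRelation r₁ r₂
  protomodular : IsProtomodular C

attribute [instance] SemiAbelian.hasZeroObject SemiAbelian.hasBinaryCoproducts

end Categories

section Cosmash

variable {C : Type u} [Category.{v} C] [HasZeroMorphisms C] [HasFiniteLimits C]
  [HasBinaryCoproducts C]

attribute [local simp] prod.lift_fst prod.lift_fst_assoc prod.lift_snd prod.lift_snd_assoc
  coprod.inl_desc coprod.inl_desc_assoc coprod.inr_desc coprod.inr_desc_assoc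
  pullback.lift_fst pullback.lift_fst_assoc pullback.lift_snd pullback.lift_snd_assoc
  kernel.lift_ι kernel.lift_ι_assoc

/-- The comparison `A + B ⟶ A × B`. -/
def sigma₂ (A B : C) : A ⨿ B ⟶ A ⨯ B :=
  coprod.desc (prod.lift (𝟙 A) 0) (prod.lift 0 (𝟙 B))

/-- The binary cosmash product `A ⋄ B`, the kernel of `A + B ⟶ A × B`. -/
def cosmash (A B : C) : C := kernel (sigma₂ A B)

/-- The kernel `h_{A,B} : A ⋄ B ⟶ A + B`. -/
def cosmashι (A B : C) : cosmash A B ⟶ A ⨿ B := kernel.ι (sigma₂ A B)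

instance (A B : C) : Mono (cosmashι A B) := inferInstanceAs (Mono (kernel.ι (sigma₂ A B)))

@[simp]
lemma coprod_map_sigma₂ {A A' B B' : C} (f : A ⟶ A') (g : B ⟶ B') :
    coprod.map f g ≫ sigma₂ A' B' = sigma₂ A B ≫ prod.map f g := by
  unfold sigma₂
  ext <;> simp

@[simp]
lemma cosmashι_sigma₂ (A B : C) : cosmashι A B ≫ sigma₂ A B = 0 :=
  kernel.condition _

@[simp]
lemma sigma₂_fst (A B : C) : sigma₂ A B ≫ prod.fst = coprod.desc (𝟙 A) 0 := by
  unfold sigma₂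
  ext <;> simp

@[simp]
lemma sigma₂_snd (A B : C) : sigma₂ A B ≫ prod.snd = coprod.desc 0 (𝟙 B) := by
  unfold sigma₂
  ext <;> simp

lemma cosmashι_desc_zero {A B Z : C} (f : A ⟶ Z) :
    cosmashι A B ≫ coprod.desc f 0 = 0 := by
  have : coprod.desc f (0 : B ⟶ Z) = sigma₂ A B ≫ prod.fst ≫ f := by
    rw [← Category.assoc, sigma₂_fst]; ext <;> simp
  rw [this, ← Category.assoc, cosmashι_sigma₂, zero_comp]

lemma cosmashι_zero_desc {A B Z : C} (f : B ⟶ Z) :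
    cosmashι A B ≫ coprod.desc 0 f = 0 := by
  have : coprod.desc (0 : A ⟶ Z) f = sigma₂ A B ≫ prod.snd ≫ f := by
    rw [← Category.assoc, sigma₂_snd]; ext <;> simp
  rw [this, ← Category.assoc, cosmashι_sigma₂, zero_comp]

/-- Functoriality `f ⋄ g` of the binary cosmash product. -/
def cosmashMap {A A' B B' : C} (f : A ⟶ A') (g : B ⟶ B') : cosmash A B ⟶ cosmash A' B' :=
  kernel.lift _ (cosmashι A B ≫ coprod.map f g) (by
    rw [Category.assoc, coprod_map_sigma₂, ← Category.assoc, cosmashι_sigma₂, zero_comp])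

@[simp]
lemma cosmashMap_ι {A A' B B' : C} (f : A ⟶ A') (g : B ⟶ B') :
    cosmashMap f g ≫ cosmashι A' B' = cosmashι A B ≫ coprod.map f g :=
  kernel.lift_ι _ _ _

@[simp]
lemma cosmashMap_ι_assoc {A A' B B' : C} (f : A ⟶ A') (g : B ⟶ B') {Z : C}
    (t : A' ⨿ B' ⟶ Z) :
    cosmashMap f g ≫ cosmashι A' B' ≫ t = cosmashι A B ≫ coprod.map f g ≫ t := by
  rw [← Category.assoc, cosmashMap_ι]; simp only [Category.assoc]

/-- The comparison `A + B + C ⟶ (A + B) × (A + C) × (B + C)`. -/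
def sigma₃ (A B D : C) : (A ⨿ B) ⨿ D ⟶ (A ⨿ B) ⨯ ((A ⨿ D) ⨯ (B ⨿ D)) :=
  prod.lift (coprod.desc (𝟙 (A ⨿ B)) 0)
    (prod.lift (coprod.desc (coprod.desc coprod.inl 0) coprod.inr)
      (coprod.desc (coprod.desc 0 coprod.inl) coprod.inr))

/-- The ternary cosmash product `A ⋄ B ⋄ C`. -/
def cosmash₃ (A B D : C) : C := kernel (sigma₃ A B D)

/-- The kernel `h_{A,B,C} : A ⋄ B ⋄ C ⟶ A + B + C`. -/
def cosmash₃ι (A B D : C) : cosmash₃ A B D ⟶ (A ⨿ B) ⨿ D := kernel.ι (sigma₃ A B D)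

@[simp]
lemma cosmash₃ι_sigma₃ (A B D : C) : cosmash₃ι A B D ≫ sigma₃ A B D = 0 :=
  kernel.condition _

lemma cosmash₃_factor {A B D X Y : C} (t : (A ⨿ B) ⨿ D ⟶ X) (r : X ⟶ Y)
    (m : (A ⨿ B) ⨯ ((A ⨿ D) ⨯ (B ⨿ D)) ⟶ Y) (h : t ≫ r = sigma₃ A B D ≫ m) :
    (cosmash₃ι A B D ≫ t) ≫ r = 0 := by
  rw [Category.assoc, h, ← Category.assoc, cosmash₃ι_sigma₃, zero_comp]

/-- Functoriality `f ⋄ g ⋄ l` of the ternary cosmash product. -/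
def cosmash₃Map {A A' B B' D D' : C} (f : A ⟶ A') (g : B ⟶ B') (l : D ⟶ D') :
    cosmash₃ A B D ⟶ cosmash₃ A' B' D' :=
  kernel.lift _ (cosmash₃ι A B D ≫ coprod.map (coprod.map f g) l)
    (cosmash₃_factor _ _
      (prod.map (coprod.map f g) (prod.map (coprod.map f l) (coprod.map g l))) (by
        unfold sigma₃; ext <;> simp))

@[simp]
lemma cosmash₃Map_ι {A A' B B' D D' : C} (f : A ⟶ A') (g : B ⟶ B') (l : D ⟶ D') :
    cosmash₃Map f g l ≫ cosmash₃ι A' B' D' =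
      cosmash₃ι A B D ≫ coprod.map (coprod.map f g) l :=
  kernel.lift_ι _ _ _

@[simp]
lemma cosmash₃Map_ι_assoc {A A' B B' D D' : C} (f : A ⟶ A') (g : B ⟶ B') (l : D ⟶ D') {Z : C}
    (t : (A' ⨿ B') ⨿ D' ⟶ Z) :
    cosmash₃Map f g l ≫ cosmash₃ι A' B' D' ≫ t =
      cosmash₃ι A B D ≫ coprod.map (coprod.map f g) l ≫ t := by
  rw [← Category.assoc, cosmash₃Map_ι]; simp only [Category.assoc]

/-- The folding morphism `S_{2,1} : A ⋄ A ⋄ B ⟶ A ⋄ B`, restricting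
`(1 1) + 1 : A + A + B ⟶ A + B`. -/
def fold₂₁ (A B : C) : cosmash₃ A A B ⟶ cosmash A B :=
  kernel.lift _ (cosmash₃ι A A B ≫ coprod.map (coprod.desc (𝟙 A) (𝟙 A)) (𝟙 B))
    (cosmash₃_factor _ _
      (prod.map (coprod.desc (𝟙 A) (𝟙 A)) (prod.snd ≫ coprod.desc 0 (𝟙 B))) (by
        unfold sigma₃ sigma₂; ext <;> simp))

@[simp]
lemma fold₂₁_ι (A B : C) : fold₂₁ A B ≫ cosmashι A B =
    cosmash₃ι A A B ≫ coprod.map (coprod.desc (𝟙 A) (𝟙 A)) (𝟙 B) :=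
  kernel.lift_ι _ _ _

@[simp]
lemma fold₂₁_ι_assoc (A B : C) {Z : C}
    (t : A ⨿ B ⟶ Z) :
    fold₂₁ A B ≫ cosmashι A B ≫ t =
      cosmash₃ι A A B ≫ coprod.map (coprod.desc (𝟙 A) (𝟙 A)) (𝟙 B) ≫ t := by
  rw [← Category.assoc, fold₂₁_ι]; simp only [Category.assoc]

/-- The folding morphism `S_{1,2} : A ⋄ B ⋄ B ⟶ A ⋄ B`, restricting
`1 + (1 1) : A + B + B ⟶ A + B`. -/
def fold₁₂ (A B : C) : cosmash₃ A B B ⟶ cosmash A B :=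
  kernel.lift _ (cosmash₃ι A B B ≫ coprod.desc (𝟙 (A ⨿ B)) coprod.inr)
    (cosmash₃_factor _ _
      (prod.map (coprod.desc (𝟙 A) 0) (prod.snd ≫ coprod.desc (𝟙 B) (𝟙 B))) (by
        unfold sigma₃ sigma₂; ext <;> simp))

@[simp]
lemma fold₁₂_ι (A B : C) : fold₁₂ A B ≫ cosmashι A B =
    cosmash₃ι A B B ≫ coprod.desc (𝟙 (A ⨿ B)) coprod.inr :=
  kernel.lift_ι _ _ _

@[simp]
lemma fold₁₂_ι_assoc (A B : C) {Z : C}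
    (t : A ⨿ B ⟶ Z) :
    fold₁₂ A B ≫ cosmashι A B ≫ t =
      cosmash₃ι A B B ≫ coprod.desc (𝟙 (A ⨿ B)) coprod.inr ≫ t := by
  rw [← Category.assoc, fold₁₂_ι]; simp only [Category.assoc]

/-- A split extension `0 ⟶ X ⟶ E ⇄ A ⟶ 0`. -/
structure SplitExt (X A : C) where
  E : C
  k : X ⟶ E
  p : E ⟶ A
  s : A ⟶ E
  s_p : s ≫ p = 𝟙 A
  k_p : k ≫ p = 0
  isKernel : Nonempty (IsLimit (KernelFork.ofι k k_p))

/-- `ψ : A ⋄ X ⟶ X` is the action core associated with a split extension of `A` by `X`. -/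
def IsActionCore {X A : C} (ψ : cosmash A X ⟶ X) : Prop :=
  ∃ S : SplitExt X A, ψ ≫ S.k = cosmashι A X ≫ coprod.desc S.s S.k

/-- The conjugation action core `A ⋄ A ⟶ A`. -/
def conjCore (A : C) : cosmash A A ⟶ A := cosmashι A A ≫ coprod.desc (𝟙 A) (𝟙 A)

variable (C) in
/-- Internal crossed modules `(X, A, ψ, ∂)`, by means of action cores. -/
structure XMod where
  X : C
  A : C
  ψ : cosmash A X ⟶ X
  bd : X ⟶ A
  isActionCore : IsActionCore ψ
  precrossed : ψ ≫ bd = cosmashMap (𝟙 A) bd ≫ conjCore A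
  peiffer : cosmashMap bd (𝟙 X) ≫ ψ = conjCore X
  ternary : cosmash₃Map (𝟙 A) bd (𝟙 X) ≫ fold₂₁ A X ≫ ψ = fold₁₂ A X ≫ ψ

namespace XMod

/-- Morphisms of internal crossed modules. -/
@[ext]
structure Hom (M N : XMod C) where
  fX : M.X ⟶ N.X
  fA : M.A ⟶ N.A
  comm : M.bd ≫ fA = fX ≫ N.bd
  equivariant : M.ψ ≫ fX = cosmashMap fA fX ≫ N.ψ

end XMod

lemma cosmashMap_id (A B : C) : cosmashMap (𝟙 A) (𝟙 B) = 𝟙 (cosmash A B) := by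
  rw [← cancel_mono (cosmashι A B)]; simp

lemma cosmashMap_comp {A A' A'' B B' B'' : C} (f : A ⟶ A') (f' : A' ⟶ A'') (g : B ⟶ B')
    (g' : B' ⟶ B'') :
    cosmashMap (f ≫ f') (g ≫ g') = cosmashMap f g ≫ cosmashMap f' g' := by
  rw [← cancel_mono (cosmashι A'' B'')]; simp

instance : Category (XMod C) where
  Hom := XMod.Hom
  id M := ⟨𝟙 _, 𝟙 _, by simp, by simp [cosmashMap_id]⟩
  comp f g := ⟨f.fX ≫ g.fX, f.fA ≫ g.fA, by
      rw [← Category.assoc, f.comm, Category.assoc, g.comm, Category.assoc], by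
      rw [cosmashMap_comp, ← Category.assoc, f.equivariant, Category.assoc, g.equivariant,
        Category.assoc]⟩
  id_comp f := by ext <;> simp
  comp_id f := by ext <;> simp
  assoc f g h := by ext <;> simp

namespace XMod

@[ext]
lemma hom_ext {M N : XMod C} {f g : M ⟶ N} (h₁ : f.fX = g.fX) (h₂ : f.fA = g.fA) : f = g :=
  XMod.Hom.ext h₁ h₂

@[simp] lemma id_fX (M : XMod C) : XMod.Hom.fX (𝟙 M) = 𝟙 M.X := rfl
@[simp] lemma id_fA (M : XMod C) : XMod.Hom.fA (𝟙 M) = 𝟙 M.A := rfl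
@[simp] lemma comp_fX {M N P : XMod C} (f : M ⟶ N) (g : N ⟶ P) :
    (f ≫ g).fX = f.fX ≫ g.fX := rfl
@[simp] lemma comp_fA {M N P : XMod C} (f : M ⟶ N) (g : N ⟶ P) :
    (f ≫ g).fA = f.fA ≫ g.fA := rfl

end XMod

/-- The object `A ♭ X`, the kernel of `(1 0) : A + X ⟶ A`. -/
abbrev flat (A X : C) : C := kernel (coprod.desc (𝟙 A) (0 : X ⟶ A))

/-- The kernel `κ_{A,X} : A ♭ X ⟶ A + X`. -/
abbrev flatι (A X : C) : flat A X ⟶ A ⨿ X := kernel.ι (coprod.desc (𝟙 A) (0 : X ⟶ A))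

@[simp]
lemma flatι_desc (A X : C) : flatι A X ≫ coprod.desc (𝟙 A) 0 = 0 := kernel.condition _

/-- Functoriality `f ♭ g`. -/
def flatMap {A A' X X' : C} (f : A ⟶ A') (g : X ⟶ X') : flat A X ⟶ flat A' X' :=
  kernel.lift _ (flatι A X ≫ coprod.map f g) (by
    have : coprod.map f g ≫ coprod.desc (𝟙 A') 0 = coprod.desc (𝟙 A) 0 ≫ f := by
      ext <;> simp
    rw [Category.assoc, this, ← Category.assoc, flatι_desc, zero_comp])

@[simp]
lemma flatMap_ι {A A' X X' : C} (f : A ⟶ A') (g : X ⟶ X') :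
    flatMap f g ≫ flatι A' X' = flatι A X ≫ coprod.map f g :=
  kernel.lift_ι _ _ _

@[simp]
lemma flatMap_ι_assoc {A A' X X' : C} (f : A ⟶ A') (g : X ⟶ X') {Z : C}
    (t : A' ⨿ X' ⟶ Z) :
    flatMap f g ≫ flatι A' X' ≫ t = flatι A X ≫ coprod.map f g ≫ t := by
  rw [← Category.assoc, flatMap_ι]; simp only [Category.assoc]

/-- The comparison `i_{A,X} : A ⋄ X ⟶ A ♭ X`. -/
def cosmashToFlat (A X : C) : cosmash A X ⟶ flat A X :=
  kernel.lift _ (cosmashι A X) (cosmashι_desc_zero _)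

@[simp]
lemma cosmashToFlat_ι (A X : C) : cosmashToFlat A X ≫ flatι A X = cosmashι A X :=
  kernel.lift_ι _ _ _

@[simp]
lemma cosmashToFlat_ι_assoc (A X : C) {Z : C}
    (t : A ⨿ X ⟶ Z) :
    cosmashToFlat A X ≫ flatι A X ≫ t = cosmashι A X ≫ t := by
  rw [← Category.assoc, cosmashToFlat_ι]

/-- The conjugation action `χ_X : X ♭ X ⟶ X`. -/
def conjAction (X : C) : flat X X ⟶ X := flatι X X ≫ coprod.desc (𝟙 X) (𝟙 X)

lemma flatMap_conjAction_comp {X Q : C} (q : X ⟶ Q) :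
    (flatMap (𝟙 X) (kernel.ι q) ≫ conjAction X) ≫ q = 0 := by
  have h : coprod.map (𝟙 X) (kernel.ι q) ≫ coprod.desc (𝟙 X) (𝟙 X) ≫ q =
      coprod.desc (𝟙 X) 0 ≫ q := by
    ext <;> simp
  unfold conjAction
  rw [Category.assoc, Category.assoc, flatMap_ι_assoc, h, ← Category.assoc, flatι_desc,
    zero_comp]

/-- The conjugation action `χ : X ♭ Y ⟶ Y` on a kernel `k : Y ⟶ X` (of some `q`), the unique
morphism with `k χ = χ_X (1 ♭ k)`. -/
def kernelAction {X Q : C} (q : X ⟶ Q) : flat X (kernel q) ⟶ kernel q :=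
  kernel.lift q (flatMap (𝟙 X) (kernel.ι q) ≫ conjAction X) (flatMap_conjAction_comp q)

lemma kernelAction_ι {X Q : C} (q : X ⟶ Q) :
    kernelAction q ≫ kernel.ι q = flatMap (𝟙 X) (kernel.ι q) ≫ conjAction X :=
  kernel.lift_ι _ _ _

/-- The action core `χ̄ = χ i : X ⋄ Y ⟶ Y` of the conjugation action on a kernel. -/
def kernelCore {X Q : C} (q : X ⟶ Q) : cosmash X (kernel q) ⟶ kernel q :=
  cosmashToFlat X (kernel q) ≫ kernelAction q

lemma kernelCore_ι {X Q : C} (q : X ⟶ Q) :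
    kernelCore q ≫ kernel.ι q = cosmashι X (kernel q) ≫ coprod.desc (𝟙 X) (kernel.ι q) := by
  unfold kernelCore
  rw [Category.assoc, kernelAction_ι, conjAction, flatMap_ι_assoc, cosmashToFlat_ι_assoc]
  congr 1
  ext <;> simp

lemma kernelCore_ι_assoc {X Q : C} (q : X ⟶ Q) {Z : C}
    (t : X ⟶ Z) :
    kernelCore q ≫ kernel.ι q ≫ t = cosmashι X (kernel q) ≫ coprod.desc (𝟙 X) (kernel.ι q) ≫ t := by
  rw [← Category.assoc, kernelCore_ι]; simp only [Category.assoc]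

lemma kernelPair_aux {X Q W : C} (q : X ⟶ Q) (g : W ⟶ pullback q q)
    (hg : g ≫ pullback.fst q q = 0) : (g ≫ pullback.snd q q) ≫ q = 0 := by
  rw [Category.assoc, ← pullback.condition, ← Category.assoc, hg, zero_comp]

/-- The split extension `Y ⟶ X ×_Q X ⇄ X` given by the kernel pair of `q : X ⟶ Q`,
where `Y` is the kernel of `q`. -/
abbrev kernelPairExt {X Q : C} (q : X ⟶ Q) : SplitExt (kernel q) X where
  E := pullback q q
  k := pullback.lift 0 (kernel.ι q) (by simp)
  p := pullback.fst q q
  s := pullback.lift (𝟙 X) (𝟙 X) rfl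
  s_p := by simp
  k_p := by simp
  isKernel := by
    have hm : Mono (pullback.lift (0 : kernel q ⟶ X) (kernel.ι q) (by simp) :
        kernel q ⟶ pullback q q) := ⟨fun a b h => by
      rw [← cancel_mono (kernel.ι q)]
      have := congrArg (· ≫ pullback.snd q q) h
      simpa using this⟩
    exact ⟨KernelFork.IsLimit.ofι' _ _ (fun {W} g hg =>
      ⟨kernel.lift q (g ≫ pullback.snd q q) (kernelPair_aux q g hg), by
        apply pullback.hom_ext
        · simp [hg]
        · simp⟩)⟩

/-- The crossed module structure on a kernel, given by conjugation. -/
def XMod.ofKernel {X Q : C} (q : X ⟶ Q) : XMod C where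
  X := kernel q
  A := X
  ψ := kernelCore q
  bd := kernel.ι q
  isActionCore := ⟨kernelPairExt q, by
    apply pullback.hom_ext
    · simp only [Category.assoc, coprod.desc_comp, pullback.lift_fst, cosmashι_desc_zero,
        comp_zero]
    · simp only [Category.assoc, coprod.desc_comp, pullback.lift_snd, kernelCore_ι]⟩
  precrossed := by
    rw [kernelCore_ι, conjCore, cosmashMap_ι_assoc]
    congr 1
    ext <;> simp
  peiffer := by
    rw [← cancel_mono (kernel.ι q), Category.assoc, kernelCore_ι, cosmashMap_ι_assoc, conjCore,
      Category.assoc]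
    congr 1
    ext <;> simp
  ternary := by
    rw [← cancel_mono (kernel.ι q)]
    simp only [Category.assoc, kernelCore_ι, fold₂₁_ι_assoc, fold₁₂_ι_assoc,
      cosmash₃Map_ι_assoc]
    congr 1
    ext <;> simp

variable (C) in
/-- The functor `L : H ↦ (H ♭ H, H + H, χ̄, κ_{H,H})`, sending `f` to `(f ♭ f, f + f)`. -/
def functorL : C ⥤ XMod C where
  obj H := XMod.ofKernel (coprod.desc (𝟙 H) (0 : H ⟶ H))
  map {H H'} f :=
    { fX := flatMap f f
      fA := coprod.map f f
      comm := (flatMap_ι f f).symm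
      equivariant := by
        change kernelCore _ ≫ flatMap f f = cosmashMap (coprod.map f f) (flatMap f f) ≫
          kernelCore _
        rw [← cancel_mono (flatι H' H'), Category.assoc, flatMap_ι, Category.assoc]
        rw [kernelCore_ι_assoc, kernelCore_ι, cosmashMap_ι_assoc]
        congr 1
        ext1
        · simp
        · have := flatMap_ι f f
          simp only [coprod.desc_comp, coprod.inr_desc, coprod.inr_map_assoc]
          exact this.symm }
  map_id H := by
    apply XMod.hom_ext
    · change flatMap _ _ = 𝟙 (flat H H)
      rw [← cancel_mono (flatι H H)]; simp
    · exact coprod.map_id_id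
  map_comp {H H' H''} f g := by
    apply XMod.hom_ext
    · change flatMap _ _ = flatMap f f ≫ flatMap g g
      rw [← cancel_mono (flatι H'' H'')]; simp
    · change coprod.map _ _ = coprod.map f f ≫ coprod.map g g
      simp

variable (C) in
/-- The functor `R : (T, G, ψ, ∂) ↦ T × G`. -/
def functorR : XMod C ⥤ C where
  obj M := M.X ⨯ M.A
  map f := prod.map f.fX f.fA

end Cosmash

section Varieties

open scoped FirstOrder

/-- Algebras of the variety given by a set `Λ` of finitary operations (a language without relation
symbols) and a set `eqs` of identities between terms in countably many variables. -/
structure VarietyAlg (Λ : FirstOrder.Language.{u, v}) (eqs : Set (Λ.Term ℕ × Λ.Term ℕ)) where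
  carrier : Type u
  [str : Λ.Structure carrier]
  identities : ∀ e ∈ eqs, ∀ x : ℕ → carrier, e.1.realize x = e.2.realize x

attribute [instance] VarietyAlg.str

variable {Λ : FirstOrder.Language.{u, v}} {eqs : Set (Λ.Term ℕ × Λ.Term ℕ)}

/-- Morphisms are the maps that preserve all operations. -/
instance : Category.{u} (VarietyAlg Λ eqs) where
  Hom P Q := P.carrier →[Λ] Q.carrier
  id P := FirstOrder.Language.Hom.id Λ P.carrier
  comp f g := g.comp f

variable (Λ eqs) in
/-- The forgetful functor from a variety to sets. -/
def VarietyAlg.forget : VarietyAlg Λ eqs ⥤ Type u where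
  obj P := P.carrier
  map {P Q} (f : P.carrier →[Λ] Q.carrier) := ↾(f : P.carrier → Q.carrier)

end Varieties

/-- `M` is a free object on the set `S` with respect to `U : D ⥤ Type`, with insertion of
generators `η`. -/
def IsFreeOn {D : Type u} [Category.{v} D] {S : Type v} (U : D ⥤ Type v) (M : D)
    (η : S → U.obj M) : Prop :=
  ∀ (N : D) (f : S → U.obj N), ∃! φ : M ⟶ N, ∀ x, U.map φ (η x) = f x

end SemiAb

end

open SemiAb

/-!
The adjunction `L ⊣ R` reads: a morphism of crossed modules from
`κ : H ♭ H ⟶ H + H` to `M = (T, G, ψ, ∂)` is the same thing as a pair `t : H ⟶ T`, `g : H ⟶ G`.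

Choose a split extension `T ⟶ E ⇄ G` (with kernel `k` and section `s`) whose action core is `ψ`.
Given `(t, g)`, the component on the base is `⟨g, ∂ t⟩ : H + H ⟶ G`, and the component on the
top object is the restriction to kernels of `⟨s g, k t⟩ : H + H ⟶ E`; on `H ⋄ H` it is
`ψ (g ⋄ t)`. Everything that remains, including uniqueness, is an equality of two morphisms out of
`H ♭ H` or out of `(H + H) ⋄ (H ♭ H)`, and protomodularity provides enough test morphisms: a split
epimorphism has its kernel and its section jointly epic (`hom_ext_of_section`). Hence

* `H ⋄ H` and `H` are jointly epic in `H ♭ H` (`flat_hom_ext`): compatibility of the two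
  components with the boundaries follows from the precrossed module condition, and the
  pair `(t, g)` determines the morphism;
* `A ⋄ D`, `B ⋄ D` and `A ⋄ B ⋄ D` are jointly epic in `(A + B) ⋄ D` (`cosmash_coprod_hom_ext`):
  applied to `(G + T) ⋄ T`, the three test morphisms give the definition of the
  action core, the Peiffer condition and the ternary condition, and
  together they say that `G + T` acts on `T` by conjugation in `E` in the same way as it acts
  through `⟨1, ∂⟩ : G + T ⟶ G` and `ψ` (`XMod.conj_eq_act`). Equivariance follows.

The forgetful functor of a variety has a left adjoint because terms modulo the identities that
hold in all algebras form a free algebra. The rest is composition of adjunctions and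
uniqueness of free objects.
-/

noncomputable section

open ZeroObject

attribute [local simp] prod.lift_fst prod.lift_fst_assoc prod.lift_snd prod.lift_snd_assoc
  coprod.inl_desc coprod.inl_desc_assoc coprod.inr_desc coprod.inr_desc_assoc
  kernel.lift_ι kernel.lift_ι_assoc kernel.condition kernel.condition_assoc

namespace SemiAb

section Protomodular

/-! ### Jointly epic morphisms in protomodular categories -/

variable {C : Type u} [Category.{v} C] [HasZeroMorphisms C] [HasFiniteLimits C]

/-- In a pointed protomodular category the section and the kernel of a split epimorphism are
jointly epic: the equalizer of two morphisms that agree on both contains the section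
and has the same kernel, so its inclusion is inverted by change of base along `0 ⟶ A`. -/
lemma hom_ext_of_section [HasZeroObject C] (hC : IsProtomodular C) {E A Z : C} (p : E ⟶ A)
    (s : A ⟶ E) (hsp : s ≫ p = 𝟙 A) {a b : E ⟶ Z} (hs : s ≫ a = s ≫ b)
    (hk : kernel.ι p ≫ a = kernel.ι p ≫ b) : a = b := by
  have hpb : IsPullback (kernel.ι p) (0 : kernel p ⟶ 0) p 0 :=
    ⟨⟨by simp⟩, ⟨PullbackCone.IsLimit.mk _
      (fun c => kernel.lift p c.fst (by rw [c.condition, comp_zero]))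
      (fun c => kernel.lift_ι _ _ _) (fun c => (isZero_zero C).eq_of_tgt _ _)
      (fun c m h _ => by rw [← cancel_mono (kernel.ι p), h, kernel.lift_ι])⟩⟩
  have hpb' : IsPullback (equalizer.lift (kernel.ι p) hk) (0 : kernel p ⟶ 0)
      (equalizer.ι a b ≫ p) 0 :=
    ⟨⟨by simp⟩, ⟨PullbackCone.IsLimit.mk _
      (fun c => kernel.lift p (c.fst ≫ equalizer.ι a b) (by
        rw [Category.assoc, c.condition, comp_zero]))
      (fun c => by rw [← cancel_mono (equalizer.ι a b)]; simp)
      (fun c => (isZero_zero C).eq_of_tgt _ _)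
      (fun c m h _ => by rw [← cancel_mono (kernel.ι p), kernel.lift_ι, ← h]; simp)⟩⟩
  have : IsIso (equalizer.ι a b) :=
    hC (0 : (0 : C) ⟶ A) (equalizer.ι a b ≫ p) (equalizer.lift s hs) p s (equalizer.ι a b)
      0 (equalizer.lift (kernel.ι p) hk) 0 (kernel.ι p) (𝟙 _) (by simp [hsp]) hsp rfl (by simp)
      hpb' hpb (by simp) (by simp) inferInstance
  rw [← cancel_epi (equalizer.ι a b), equalizer.condition]

variable [HasBinaryCoproducts C]

/-- The factorization of `inr : X ⟶ A + X` through `A ♭ X`. -/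
def toFlat (A X : C) : X ⟶ flat A X := kernel.lift _ coprod.inr (coprod.inr_desc _ _)

@[simp]
lemma toFlat_ι (A X : C) : toFlat A X ≫ flatι A X = coprod.inr := kernel.lift_ι _ _ _

@[simp]
lemma toFlat_ι_assoc (A X : C) {Z : C} (t : A ⨿ X ⟶ Z) :
    toFlat A X ≫ flatι A X ≫ t = coprod.inr ≫ t := by
  rw [← Category.assoc, toFlat_ι]

lemma cosmash_exists_lift {W A B : C} (f : W ⟶ A ⨿ B) (hf : f ≫ sigma₂ A B = 0) :
    ∃ l : W ⟶ cosmash A B, l ≫ cosmashι A B = f :=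
  ⟨kernel.lift _ f hf, kernel.lift_ι _ _ _⟩

lemma cosmash₃_exists_lift {W A B D : C} (f : W ⟶ (A ⨿ B) ⨿ D) (hf : f ≫ sigma₃ A B D = 0) :
    ∃ l : W ⟶ cosmash₃ A B D, l ≫ cosmash₃ι A B D = f :=
  ⟨kernel.lift _ f hf, kernel.lift_ι _ _ _⟩

/-- `A ⋄ X` is the kernel of the split epimorphism `⟨0, 1⟩ : A ♭ X ⟶ X`, so that it is jointly
epic with `X`. -/
lemma flat_hom_ext [HasZeroObject C] (hC : IsProtomodular C) {A X Z : C} {a b : flat A X ⟶ Z}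
    (h₁ : cosmashToFlat A X ≫ a = cosmashToFlat A X ≫ b)
    (h₂ : toFlat A X ≫ a = toFlat A X ≫ b) : a = b := by
  refine hom_ext_of_section hC (flatι A X ≫ coprod.desc 0 (𝟙 X)) (toFlat A X) (by simp) h₂ ?_
  have hw : (kernel.ι (flatι A X ≫ coprod.desc 0 (𝟙 X)) ≫ flatι A X) ≫ sigma₂ A X = 0 := by
    apply Limits.prod.hom_ext
    · simp only [Category.assoc, sigma₂_fst, flatι_desc, comp_zero, zero_comp]
    · simp only [Category.assoc, sigma₂_snd, kernel.condition, zero_comp]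
  obtain ⟨l, hl⟩ := cosmash_exists_lift _ hw
  have : kernel.ι (flatι A X ≫ coprod.desc 0 (𝟙 X)) = l ≫ cosmashToFlat A X := by
    rw [← cancel_mono (flatι A X), Category.assoc, cosmashToFlat_ι, hl]
  rw [this, Category.assoc, h₁, Category.assoc]

/-- The inclusion `A ⋄ B ⋄ D ⟶ (A + B) ⋄ D`. -/
def cosmash₃ToCosmash (A B D : C) : cosmash₃ A B D ⟶ cosmash (A ⨿ B) D :=
  kernel.lift _ (cosmash₃ι A B D) (by
    have := cosmash₃_factor (𝟙 _) (sigma₂ (A ⨿ B) D)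
      (prod.map (𝟙 (A ⨿ B)) (prod.snd ≫ coprod.desc 0 (𝟙 D))) (by
        unfold sigma₃ sigma₂; ext <;> simp)
    rwa [Category.comp_id] at this)

@[simp]
lemma cosmash₃ToCosmash_ι (A B D : C) :
    cosmash₃ToCosmash A B D ≫ cosmashι (A ⨿ B) D = cosmash₃ι A B D :=
  kernel.lift_ι _ _ _

@[simp]
lemma cosmash₃ToCosmash_ι_assoc (A B D : C) {Z : C} (t : (A ⨿ B) ⨿ D ⟶ Z) :
    cosmash₃ToCosmash A B D ≫ cosmashι (A ⨿ B) D ≫ t = cosmash₃ι A B D ≫ t := by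
  rw [← Category.assoc, cosmash₃ToCosmash_ι]

lemma cosmashMap_zero {A A' B B' : C} (g : B ⟶ B') :
    cosmashMap (0 : A ⟶ A') g = 0 := by
  rw [← cancel_mono (cosmashι A' B'), cosmashMap_ι, zero_comp]
  have : coprod.map (0 : A ⟶ A') g = coprod.desc 0 (g ≫ coprod.inr) := by ext <;> simp
  rw [this, cosmashι_zero_desc]

/-- The kernel of the split epimorphism `(A + B) ⋄ D ⟶ A ⋄ D` maps onto `B ⋄ D` by a split
epimorphism with kernel `A ⋄ B ⋄ D`. -/
lemma cosmash_coprod_hom_ext [HasZeroObject C] (hC : IsProtomodular C) {A B D Z : C}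
    {a b : cosmash (A ⨿ B) D ⟶ Z}
    (h₁ : cosmashMap coprod.inl (𝟙 D) ≫ a = cosmashMap coprod.inl (𝟙 D) ≫ b)
    (h₂ : cosmashMap coprod.inr (𝟙 D) ≫ a = cosmashMap coprod.inr (𝟙 D) ≫ b)
    (h₃ : cosmash₃ToCosmash A B D ≫ a = cosmash₃ToCosmash A B D ≫ b) : a = b := by
  let p : cosmash (A ⨿ B) D ⟶ cosmash A D := cosmashMap (coprod.desc (𝟙 A) 0) (𝟙 D)
  let p' : cosmash (A ⨿ B) D ⟶ cosmash B D := cosmashMap (coprod.desc 0 (𝟙 B)) (𝟙 D)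
  refine hom_ext_of_section hC p (cosmashMap coprod.inl (𝟙 D))
    (by simp [p, ← cosmashMap_comp, cosmashMap_id]) h₁ ?_
  have hs : cosmashMap coprod.inr (𝟙 D) ≫ p = 0 := by
    simp [p, ← cosmashMap_comp, cosmashMap_zero]
  refine hom_ext_of_section hC (kernel.ι p ≫ p') (kernel.lift p _ hs)
    (by simp [p', ← cosmashMap_comp, cosmashMap_id]) (by simpa using h₂) ?_
  obtain ⟨w, hw₀⟩ : ∃ w, w = kernel.ι (kernel.ι p ≫ p') ≫ kernel.ι p := ⟨_, rfl⟩
  have hp : w ≫ p = 0 := by simp [hw₀]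
  have hp' : w ≫ p' = 0 := by simp [hw₀]
  have hw : (w ≫ cosmashι (A ⨿ B) D) ≫ sigma₃ A B D = 0 := by
    have e₁ : coprod.desc (coprod.desc coprod.inl 0) coprod.inr =
        coprod.map (coprod.desc (𝟙 A) (0 : B ⟶ A)) (𝟙 D) := by ext <;> simp
    have e₂ : coprod.desc (coprod.desc 0 coprod.inl) coprod.inr =
        coprod.map (coprod.desc (0 : A ⟶ B) (𝟙 B)) (𝟙 D) := by ext <;> simp
    unfold sigma₃
    apply Limits.prod.hom_ext
    · simp only [Category.assoc, prod.lift_fst, zero_comp, cosmashι_desc_zero, comp_zero]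
    · apply Limits.prod.hom_ext
      · simp only [Category.assoc, prod.lift_snd, prod.lift_fst, zero_comp, e₁]
        rw [← cosmashMap_ι, ← Category.assoc]
        exact (congrArg (· ≫ _) hp).trans zero_comp
      · simp only [Category.assoc, prod.lift_snd, zero_comp, e₂]
        rw [← cosmashMap_ι, ← Category.assoc]
        exact (congrArg (· ≫ _) hp').trans zero_comp
  obtain ⟨l, hl⟩ := cosmash₃_exists_lift _ hw
  have : w = l ≫ cosmash₃ToCosmash A B D := by
    rw [← cancel_mono (cosmashι (A ⨿ B) D), Category.assoc, cosmash₃ToCosmash_ι, hl]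
  have key : w ≫ a = w ≫ b := by rw [this, Category.assoc, h₃, Category.assoc]
  simpa [hw₀] using key

end Protomodular

section Adjunction

/-! ### The adjunction between `L` and `R` -/

variable {C : Type u} [Category.{v} C] [HasZeroMorphisms C] [HasFiniteLimits C]
  [HasBinaryCoproducts C]

namespace SplitExt

variable {X A : C} (S : SplitExt X A)

instance : Mono S.k := by
  obtain ⟨h⟩ := S.isKernel
  exact mono_of_isLimit_fork h

lemma exists_lift {W : C} (f : W ⟶ S.E) (hf : f ≫ S.p = 0) : ∃ g : W ⟶ X, g ≫ S.k = f := by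
  obtain ⟨h⟩ := S.isKernel
  exact ⟨_, (KernelFork.IsLimit.lift' h f hf).2⟩

end SplitExt

namespace XMod

variable (M : XMod C)

/-- A split extension of `A` by `X` whose action core is the action core of `M`. -/
def ext : SplitExt M.X M.A := M.isActionCore.choose

lemma ψ_k : M.ψ ≫ M.ext.k = cosmashι M.A M.X ≫ coprod.desc M.ext.s M.ext.k :=
  M.isActionCore.choose_spec

/-- Acting on `X` by conjugation in the split extension `E`, along `⟨s, k⟩ : A + X ⟶ E`, is the
same as acting by `ψ` along `⟨1, ∂⟩ : A + X ⟶ A`. On the three jointly epic parts of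
`(A + X) ⋄ X` this is the definition of the action core, the Peiffer condition and the
ternary condition. -/
lemma conj_eq_act [HasZeroObject C] (hC : IsProtomodular C) :
    cosmashι (M.A ⨿ M.X) M.X ≫ coprod.desc (coprod.desc M.ext.s M.ext.k) M.ext.k =
      cosmashMap (coprod.desc (𝟙 M.A) M.bd) (𝟙 M.X) ≫ M.ψ ≫ M.ext.k := by
  apply cosmash_coprod_hom_ext hC
  -- On `A ⋄ X` both sides are `k ψ`.
  · rw [cosmashMap_ι_assoc, ← Category.assoc (cosmashMap _ _) (cosmashMap _ _), ← cosmashMap_comp, coprod.inl_desc,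
      Category.comp_id, cosmashMap_id, Category.id_comp, ψ_k]
    congr 1
    ext <;> simp
  -- On `X ⋄ X`: the Peiffer condition.
  · rw [cosmashMap_ι_assoc, ← Category.assoc (cosmashMap _ _) (cosmashMap _ _), ← cosmashMap_comp, coprod.inr_desc,
      Category.comp_id, ← Category.assoc (cosmashMap _ _) M.ψ, M.peiffer, conjCore, Category.assoc]
    congr 1
    ext <;> simp
  -- On `A ⋄ X ⋄ X`: the ternary condition.
  · have h := congrArg (· ≫ M.ext.k) M.ternary
    simp only [Category.assoc, ψ_k, fold₂₁_ι_assoc, fold₁₂_ι_assoc, cosmash₃Map_ι_assoc] at h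
    rw [ψ_k, cosmashMap_ι_assoc, cosmash₃ToCosmash_ι_assoc, cosmash₃ToCosmash_ι_assoc]
    have e₁ : coprod.desc (coprod.desc M.ext.s M.ext.k) M.ext.k =
        coprod.desc (𝟙 (M.A ⨿ M.X)) coprod.inr ≫ coprod.desc M.ext.s M.ext.k := by
      ext <;> simp
    rw [e₁, ← h]
    congr 1
    ext <;> simp

variable {M} {H : C} (t : H ⟶ M.X) (g : H ⟶ M.A)

lemma exists_flat_lift : ∃ f : flat H H ⟶ M.X,
    f ≫ M.ext.k = flatι H H ≫ coprod.desc (g ≫ M.ext.s) (t ≫ M.ext.k) := by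
  apply M.ext.exists_lift
  have : coprod.desc (g ≫ M.ext.s) (t ≫ M.ext.k) ≫ M.ext.p = coprod.desc (𝟙 H) 0 ≫ g := by
    ext <;> simp [M.ext.s_p, M.ext.k_p]
  rw [Category.assoc, this, ← Category.assoc, flatι_desc, zero_comp]

/-- The morphism `H ♭ H ⟶ X` induced by `t : H ⟶ X` and `g : H ⟶ A`: the restriction to kernels
of `⟨s g, k t⟩ : H + H ⟶ E`. -/
def flatLift : flat H H ⟶ M.X := (exists_flat_lift t g).choose

lemma flatLift_k : flatLift t g ≫ M.ext.k =
    flatι H H ≫ coprod.desc (g ≫ M.ext.s) (t ≫ M.ext.k) :=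
  (exists_flat_lift t g).choose_spec

lemma toFlat_flatLift : toFlat H H ≫ flatLift t g = t := by
  rw [← cancel_mono M.ext.k, Category.assoc, flatLift_k, toFlat_ι_assoc, coprod.inr_desc]

lemma cosmashToFlat_flatLift :
    cosmashToFlat H H ≫ flatLift t g = cosmashMap g t ≫ M.ψ := by
  rw [← cancel_mono M.ext.k, Category.assoc, flatLift_k, cosmashToFlat_ι_assoc, Category.assoc,
    ψ_k, cosmashMap_ι_assoc]
  congr 1
  ext <;> simp

/-- Compatibility with the boundaries. On `H ⋄ H` this is the precrossed module condition, and on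
`H` both sides are `∂ t`. -/
lemma flatι_desc_bd [HasZeroObject C] (hC : IsProtomodular C) :
    flatι H H ≫ coprod.desc g (t ≫ M.bd) = flatLift t g ≫ M.bd := by
  apply flat_hom_ext hC
  · rw [← Category.assoc, ← Category.assoc, cosmashToFlat_ι, cosmashToFlat_flatLift,
      Category.assoc, M.precrossed, ← Category.assoc, ← cosmashMap_comp, conjCore,
      cosmashMap_ι_assoc]
    congr 1
    ext <;> simp
  · rw [toFlat_ι_assoc, coprod.inr_desc, ← Category.assoc, toFlat_flatLift]

/-- Equivariance. After composition with the kernel `k`, the left-hand side is conjugation in `E`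
along `⟨s g, k t⟩`, which `conj_eq_act` turns into the action along `⟨g, ∂ t⟩`. -/
lemma kernelCore_flatLift [HasZeroObject C] (hC : IsProtomodular C) :
    kernelCore (coprod.desc (𝟙 H) (0 : H ⟶ H)) ≫ flatLift t g =
      cosmashMap (coprod.desc g (t ≫ M.bd)) (flatLift t g) ≫ M.ψ := by
  have e : cosmashMap (coprod.desc g (t ≫ M.bd)) (flatLift t g) =
      cosmashMap (coprod.map g t) (flatLift t g) ≫
        cosmashMap (coprod.desc (𝟙 M.A) M.bd) (𝟙 M.X) := by
    rw [← cosmashMap_comp, Category.comp_id]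
    congr 1
    ext <;> simp
  rw [← cancel_mono M.ext.k, e, Category.assoc, Category.assoc, Category.assoc,
    ← M.conj_eq_act hC, flatLift_k, kernelCore_ι_assoc, cosmashMap_ι_assoc]
  congr 1
  ext1
  · ext <;> simp
  · have := flatLift_k t g
    simpa using this.symm

/-- The morphism of crossed modules `L(H) ⟶ M` induced by `t : H ⟶ X` and `g : H ⟶ A`. -/
def ofPair [HasZeroObject C] (hC : IsProtomodular C) : (functorL C).obj H ⟶ M where
  fX := flatLift t g
  fA := coprod.desc g (t ≫ M.bd)
  comm := flatι_desc_bd t g hC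
  equivariant := kernelCore_flatLift t g hC

/-- The conjugation action of `H + H` on `H ♭ H` restricts on `H ⋄ H` to the inclusion. -/
lemma cosmashMap_kernelCore : cosmashMap coprod.inl (toFlat H H) ≫
    kernelCore (coprod.desc (𝟙 H) (0 : H ⟶ H)) = cosmashToFlat H H := by
  rw [← cancel_mono (flatι H H), cosmashToFlat_ι, Category.assoc, kernelCore_ι,
    cosmashMap_ι_assoc]
  have : coprod.map coprod.inl (toFlat H H) ≫ coprod.desc (𝟙 (H ⨿ H)) (flatι H H) = 𝟙 _ := by
    ext <;> simp
  rw [this, Category.comp_id]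

/-- The top component of an equivariant pair is determined by its values on generators: on `H ⋄ H`
equivariance forces it to be `ψ (g ⋄ t)`. -/
lemma flatLift_eq [HasZeroObject C] (hC : IsProtomodular C) {a : flat H H ⟶ M.X}
    {b : H ⨿ H ⟶ M.A} (h : kernelCore (coprod.desc (𝟙 H) (0 : H ⟶ H)) ≫ a =
      cosmashMap b a ≫ M.ψ) : flatLift (toFlat H H ≫ a) (coprod.inl ≫ b) = a := by
  refine flat_hom_ext hC ?_ (toFlat_flatLift _ _)
  rw [cosmashToFlat_flatLift, cosmashMap_comp, Category.assoc, ← h, ← Category.assoc,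
    cosmashMap_kernelCore]

lemma desc_toFlat_eq {a : flat H H ⟶ M.X} {b : H ⨿ H ⟶ M.A} (h : flatι H H ≫ b = a ≫ M.bd) :
    coprod.desc (coprod.inl ≫ b) ((toFlat H H ≫ a) ≫ M.bd) = b := by
  rw [Category.assoc, ← h, toFlat_ι_assoc]
  ext <;> simp

lemma ofPair_eq [HasZeroObject C] (hC : IsProtomodular C) (φ : (functorL C).obj H ⟶ M) :
    ofPair (toFlat H H ≫ φ.fX) (coprod.inl ≫ φ.fA) hC = φ :=
  XMod.hom_ext (flatLift_eq hC φ.equivariant) (desc_toFlat_eq φ.comm)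

variable (H M) in
/-- Morphisms `L(H) ⟶ M` correspond to morphisms `H ⟶ X × A`. -/
def homEquiv [HasZeroObject C] (hC : IsProtomodular C) :
    ((functorL C).obj H ⟶ M) ≃ (H ⟶ (functorR C).obj M) where
  toFun φ := prod.lift (toFlat H H ≫ φ.fX) (coprod.inl ≫ φ.fA)
  invFun f := ofPair (f ≫ prod.fst) (f ≫ prod.snd) hC
  left_inv φ := (congrArg₂ (fun t g => ofPair t g hC) (prod.lift_fst _ _)
    (prod.lift_snd _ _)).trans (ofPair_eq hC φ)
  right_inv f := by
    apply Limits.prod.hom_ext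
    · rw [prod.lift_fst]
      exact toFlat_flatLift _ _
    · rw [prod.lift_snd]
      exact coprod.inl_desc _ _

end XMod

lemma toFlat_flatMap_assoc {A A' X X' Z : C} (f : A ⟶ A') (g : X ⟶ X') (a : flat A' X' ⟶ Z) :
    toFlat A X ≫ flatMap f g ≫ a = g ≫ toFlat A' X' ≫ a := by
  have : toFlat A X ≫ flatMap f g = g ≫ toFlat A' X' := by
    rw [← cancel_mono (flatι A' X')]
    simp
  rw [← Category.assoc, this, Category.assoc]

variable (C) in
/-- The adjunction between `L` and `R`. -/
def adjunctionLR [HasZeroObject C] (hC : IsProtomodular C) : functorL C ⊣ functorR C :=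
  Adjunction.mkOfHomEquiv
    { homEquiv := fun H M => XMod.homEquiv M H hC
      homEquiv_naturality_left_symm := fun {H' H M} f g => by
        rw [Equiv.symm_apply_eq]
        obtain ⟨φ, rfl⟩ := (XMod.homEquiv M H hC).surjective g
        rw [Equiv.symm_apply_apply]
        apply Limits.prod.hom_ext
        · change (f ≫ prod.lift _ _) ≫ prod.fst = prod.lift _ _ ≫ prod.fst
          rw [Category.assoc, prod.lift_fst, prod.lift_fst]
          exact (toFlat_flatMap_assoc f f φ.fX).symm
        · change (f ≫ prod.lift _ _) ≫ prod.snd = prod.lift _ _ ≫ prod.snd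
          rw [Category.assoc, prod.lift_snd, prod.lift_snd]
          exact (coprod.inl_map_assoc f f φ.fA).symm
      homEquiv_naturality_right := fun {H M M'} φ ψ => by
        change prod.lift _ _ = prod.lift _ _ ≫ prod.map ψ.fX ψ.fA
        rw [prod.lift_map]
        exact congrArg₂ prod.lift (Category.assoc _ _ _).symm (Category.assoc _ _ _).symm }

end Adjunction

section Free

/-! ### Free algebras of a variety -/

open FirstOrder Language

variable {Λ : FirstOrder.Language.{u, v}} (eqs : Set (Λ.Term ℕ × Λ.Term ℕ)) (S : Type u)

namespace VarietyAlg

/-- Two terms are identified if they take the same value in every algebra of the variety. -/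
def termSetoid : Setoid (Λ.Term S) where
  r a b := ∀ (P : VarietyAlg Λ eqs) (x : S → P.carrier), a.realize x = b.realize x
  iseqv := ⟨fun _ _ _ => rfl, fun h P x => (h P x).symm, fun h h' P x => (h P x).trans (h' P x)⟩

/-- The absolutely free structure on the terms, with empty relations. -/
@[reducible]
def termPrestructure : Λ.Prestructure (termSetoid eqs S) where
  toStructure := { funMap := fun f ts => Term.func f ts, RelMap := fun _ _ => False }
  fun_equiv := fun {n f} a b h P x => by
    change Term.realize x (Term.func f a) = Term.realize x (Term.func f b)
    rw [Term.realize_func, Term.realize_func]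
    congr 1
    funext i
    exact h i P x
  rel_equiv := fun _ _ _ => rfl

attribute [local instance] termPrestructure

/-- Evaluating a term at terms is substitution. -/
lemma realize_term (e : Λ.Term ℕ) (x : ℕ → Λ.Term S) :
    @Term.realize Λ _ (termPrestructure eqs S).toStructure _ x e = e.subst x := by
  induction e with
  | var => rfl
  | func f ts ih => exact congrArg (Term.func f) (funext ih)

/-- The free algebra on `S`. -/
def free : VarietyAlg Λ eqs where
  carrier := Quotient (termSetoid eqs S)
  identities e he x := by
    obtain ⟨y, rfl⟩ : ∃ y : ℕ → Λ.Term S, x = fun i => (⟦y i⟧ : Quotient (termSetoid eqs S)) :=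
      ⟨fun i => (x i).out, funext fun i => (Quotient.out_eq _).symm⟩
    rw [Term.realize_quotient_mk', Term.realize_quotient_mk', realize_term, realize_term]
    refine Quotient.sound fun P z => ?_
    rw [Term.realize_subst, Term.realize_subst]
    exact P.identities e he _

variable {eqs S}

/-- The insertion of generators. -/
def freeι (x : S) : (free eqs S).carrier := (⟦Term.var x⟧ : Quotient (termSetoid eqs S))

variable [Λ.IsAlgebraic]

/-- The extension of a map on generators, by evaluation of terms. -/
def freeLift {P : VarietyAlg Λ eqs} (f : S → P.carrier) : free eqs S ⟶ P :=
  show (free eqs S).carrier →[Λ] P.carrier from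
  { toFun := Quotient.lift (fun t : Λ.Term S => t.realize f) fun _ _ h => h P f
    map_fun' := fun {n} φ x => by
      obtain ⟨y, rfl⟩ : ∃ y : Fin n → Λ.Term S,
          x = fun i => (⟦y i⟧ : Quotient (termSetoid eqs S)) :=
        ⟨fun i => Quotient.out (x i), funext fun i => (Quotient.out_eq (x i)).symm⟩
      exact congrArg _ (funMap_quotient_mk' (termSetoid eqs S) φ y)
    map_rel' := fun {n} r => isEmptyElim r }

lemma realize_freeι (t : Λ.Term S) :
    t.realize (M := (free eqs S).carrier) freeι = (⟦t⟧ : Quotient (termSetoid eqs S)) := by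
  refine (Term.realize_quotient_mk' (termSetoid eqs S) t Term.var).trans ?_
  congr 1
  induction t with
  | var => rfl
  | func f ts ih => exact congrArg (Term.func f) (funext ih)

lemma free_hom_ext {P : VarietyAlg Λ eqs} {φ ψ : (free eqs S).carrier →[Λ] P.carrier}
    (h : ∀ x, φ (freeι x) = ψ (freeι x)) : φ = ψ := by
  ext x
  obtain ⟨t, rfl⟩ := Quotient.exists_rep x
  rw [← realize_freeι]
  erw [← HomClass.realize_term, ← HomClass.realize_term]
  congr 1
  exact funext h

variable (S) in
/-- The universal property of the free algebra. -/
def freeEquiv (P : VarietyAlg Λ eqs) :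
    (free eqs S ⟶ P) ≃ (S ⟶ (forget Λ eqs).obj P) where
  toFun φ := ↾fun x => (show (free eqs S).carrier →[Λ] P.carrier from φ) (freeι x)
  invFun f := freeLift (fun x => f x)
  left_inv _ := free_hom_ext fun _ => rfl
  right_inv _ := rfl

instance : (forget Λ eqs).IsRightAdjoint :=
  (Adjunction.adjunctionOfEquivLeft (F_obj := fun S => free eqs S) (fun S P => freeEquiv S P)
    (fun _ _ _ _ _ => rfl)).isRightAdjoint

end VarietyAlg

/-- A free object in the sense of `IsFreeOn` is isomorphic to the value of any left adjoint. -/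
lemma IsFreeOn.nonempty_iso {D : Type u} [Category.{v} D] {S : Type v} {U : D ⥤ Type v} {M : D}
    {η : S → U.obj M} (h : IsFreeOn U M η) {F : Type v ⥤ D} (adj : F ⊣ U) :
    Nonempty (M ≅ F.obj S) := by
  obtain ⟨φ, hφ, -⟩ := h (F.obj S) (adj.unit.app S)
  let ψ : F.obj S ⟶ M := (adj.homEquiv S M).symm (↾η)
  have hψ : ∀ x, U.map ψ (adj.unit.app S x) = η x := fun x => by
    have : adj.unit.app S ≫ U.map ψ = ↾η :=
      (adj.homEquiv_unit S M ψ).symm.trans (Equiv.apply_symm_apply _ _)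
    exact congrArg (fun k : S ⟶ U.obj M => k x) this
  refine ⟨⟨φ, ψ, ?_, ?_⟩⟩
  · refine (h M η).unique (fun x => ?_) (fun x => by simp)
    rw [U.map_comp, types_comp_apply, hφ, hψ]
  · apply (adj.homEquiv S _).injective
    rw [adj.homEquiv_naturality_right, Equiv.apply_symm_apply, adj.homEquiv_id]
    ext x
    exact hφ x

end Free

end SemiAb

end

open SemiAb
theorem mainTheorem2 (Λ : FirstOrder.Language.{u, v}) [Λ.IsAlgebraic]
    (eqs : Set (Λ.Term ℕ × Λ.Term ℕ))
    [HasZeroMorphisms (VarietyAlg Λ eqs)] [SemiAbelian (VarietyAlg Λ eqs)] :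
    Nonempty (functorL (VarietyAlg Λ eqs) ⊣ functorR (VarietyAlg Λ eqs)) ∧
    (VarietyAlg.forget Λ eqs).IsRightAdjoint ∧
    ∀ F : Type u ⥤ VarietyAlg Λ eqs, Nonempty (F ⊣ VarietyAlg.forget Λ eqs) →
      Nonempty (F ⋙ functorL (VarietyAlg Λ eqs) ⊣
        functorR (VarietyAlg Λ eqs) ⋙ VarietyAlg.forget Λ eqs) ∧
      ∀ (S : Type u) (M : XMod (VarietyAlg Λ eqs))
        (η : S → (functorR (VarietyAlg Λ eqs) ⋙ VarietyAlg.forget Λ eqs).obj M),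
        IsFreeOn (functorR (VarietyAlg Λ eqs) ⋙ VarietyAlg.forget Λ eqs) M η →
        Nonempty (M ≅ (functorL (VarietyAlg Λ eqs)).obj (F.obj S)) := by
  have adj := adjunctionLR (VarietyAlg Λ eqs) SemiAbelian.protomodular
  refine ⟨⟨adj⟩, inferInstance, fun F ⟨adjF⟩ => ⟨⟨adjF.comp adj⟩, fun S M η h => ?_⟩⟩
  exact h.nonempty_iso (adjF.comp adj)
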